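/- Let $d\ge 1$, let $f:\mathbb{R}^d\to[0,\infty)$ be a (Borel) probability density with respect to Lebesgue measure, and let $X_1,X_2,\dots$ be i.i.d. random vectors in $\mathbb{R}^d$ with density $f$. Let $\rho(x,y)=|x-y|$ be the Euclidean distance, $B(x,r)$ the closed ball of radius $r$ centred at $x$, and $V_d=\pi^{d/2}/\Gamma(\tfrac d2+1)$. For $N\ge 2$ put $\rho_i=\min_{1\le j\le N,\,j\ne i}\rho(X_i,X_j)$, $\overline\rho=(\rho_1\cdots\rho_N)^{1/N}$, and $$H_N=d\log\overline\rho+\log V_d+\gamma+\log(N-1),$$ where $\gamma$ is the Euler constant. Let $H=-\int_{\mathbb{R}^d} f(x)\log f(x)\,dx$ (with $0\log 0=0$). Put $G(t)=0$ for $0\le t<1$ and $G(t)=t\log t$ for $t\ge 1$, and for $x\in\mathbb{R}^d$, $R>0$ $$I_f(x,r)=\frac{1}{r^dV_d}\int_{B(x,r)}f(y)\,dy,\qquad M_f(x,R)=\sup_{0<r\le R}I_f(x,r),\qquad m_f(x,R)=\inf_{0<r\le R}I_f(x,r).$$ Assume that for some positive $\varepsilon_0,\varepsilon_1,\varepsilon_2,R_1,R_2$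 the following integrals are finite: $$K_f(\varepsilon_0)=\int_{\mathbb{R}^d}\Big(\int_{\mathbb{R}^d}G(|\log\rho(x,y)|)f(y)\,dy\Big)^{1+\varepsilon_0}f(x)\,dx,$$ $$Q_f(\varepsilon_1,R_1)=\int_{\mathbb{R}^d}M_f(x,R_1)^{\varepsilon_1}f(x)\,dx,\qquad T_f(\varepsilon_2,R_2)=\int_{\mathbb{R}^d}m_f(x,R_2)^{-\varepsilon_2}f(x)\,dx$$ (with $0^{-\varepsilon_2}=\infty$ and $\infty\cdot 0=0$). Then $f\log f$ is integrable, so that $H$ is finite; $H_N$ is integrable for all sufficiently large $N$; and $$\lim_{N\to\infty}\mathsf{E}H_N=H.$$ -/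

import Mathlib

open MeasureTheory ProbabilityTheory Filter Topology Set
open scoped ENNReal

noncomputable section

namespace KozachenkoLeonenko

/-- The volume `V_d = π^{d/2} / Γ(d/2 + 1)` of the unit ball of `ℝ^d`. -/
def unitBallVolume (d : ℕ) : ℝ :=
  Real.pi ^ ((d : ℝ) / 2) / Real.Gamma ((d : ℝ) / 2 + 1)

/-- `ρ_i`: the distance from `x i` to its nearest neighbour among the other points of the sample
(a minimum over a finite set, nonempty as soon as `2 ≤ N`). -/
def nnDist {d N : ℕ} (x : Fin N → EuclideanSpace ℝ (Fin d)) (i : Fin N) : ℝ :=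
  ⨅ j : {j : Fin N // j ≠ i}, dist (x i) (x j)

/-- The geometric mean `(ρ_1 ⋯ ρ_N)^{1/N}` of the nearest-neighbour distances. -/
def nnGeomMean {d N : ℕ} (x : Fin N → EuclideanSpace ℝ (Fin d)) : ℝ :=
  (∏ i, nnDist x i) ^ (1 / (N : ℝ))

/-- The estimate `d log ρ̄ + log V_d + γ + log (N - 1)`. For an i.i.d. sample from a density on
`ℝ^d`, `d ≥ 1`, almost surely `ρ̄ > 0`, so the value of `log` at `0` does not matter. -/
def estimator {d N : ℕ} (x : Fin N → EuclideanSpace ℝ (Fin d)) : ℝ :=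
  (d : ℝ) * Real.log (nnGeomMean x) + Real.log (unitBallVolume d)
    + Real.eulerMascheroniConstant + Real.log ((N : ℝ) - 1)

/-- The differential entropy `H(f) = -∫ f log f`, with `0 log 0 = 0`. -/
def entropy {d : ℕ} (f : EuclideanSpace ℝ (Fin d) → ℝ) : ℝ :=
  -∫ x, f x * Real.log (f x)

/-- `G(t) = 0` for `t < 1` and `G(t) = t log t` for `t ≥ 1`. -/
def G (t : ℝ) : ℝ := if t < 1 then 0 else t * Real.log t

/-- The mean `I_f(x, r)` of `f` over the closed ball `B(x, r)`. -/
def ballMean {d : ℕ} (f : EuclideanSpace ℝ (Fin d) → ℝ) (x : EuclideanSpace ℝ (Fin d)) (r : ℝ) :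
    ℝ≥0∞ :=
  (∫⁻ y in Metric.closedBall x r, ENNReal.ofReal (f y)) /
    ENNReal.ofReal (r ^ d * unitBallVolume d)

/-- The local maximal function `M_f(x, R)`, with values in `[0, ∞]`. -/
def localMax {d : ℕ} (f : EuclideanSpace ℝ (Fin d) → ℝ) (x : EuclideanSpace ℝ (Fin d)) (R : ℝ) :
    ℝ≥0∞ :=
  ⨆ r ∈ Ioc (0 : ℝ) R, ballMean f x r

/-- The local minimal function `m_f(x, R)`. -/
def localMin {d : ℕ} (f : EuclideanSpace ℝ (Fin d) → ℝ) (x : EuclideanSpace ℝ (Fin d)) (R : ℝ) :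
    ℝ≥0∞ :=
  ⨅ r ∈ Ioc (0 : ℝ) R, ballMean f x r

/-- `K_f(ε)`. The inner integrand at `y = x` does not matter, since `{x}` is a null set
when `d ≥ 1`. -/
def K {d : ℕ} (f : EuclideanSpace ℝ (Fin d) → ℝ) (ε : ℝ) : ℝ≥0∞ :=
  ∫⁻ x, (∫⁻ y, ENNReal.ofReal (G |Real.log (dist x y)|) * ENNReal.ofReal (f y)) ^ (1 + ε)
    * ENNReal.ofReal (f x)

/-- `Q_f(ε, R)`. -/
def Q {d : ℕ} (f : EuclideanSpace ℝ (Fin d) → ℝ) (ε R : ℝ) : ℝ≥0∞ :=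
  ∫⁻ x, localMax f x R ^ ε * ENNReal.ofReal (f x)

/-- `T_f(ε, R)`; here `0 ^ (-ε) = ∞` for `ε > 0`, and `∞ * 0 = 0`. -/
def T {d : ℕ} (f : EuclideanSpace ℝ (Fin d) → ℝ) (ε R : ℝ) : ℝ≥0∞ :=
  ∫⁻ x, localMin f x R ^ (-ε) * ENNReal.ofReal (f x)

end KozachenkoLeonenko

end

/-!
Let `μ` be the law with density `f`, let `ρ` be the nearest-neighbour distance of `X 0` among the
first `N` points, and let `U = μ(B(X 0, ρ))`. Given `X 0 = x`, the probability integral transform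
makes the numbers `μ(B(x, |x - X j|))` independent and uniform on `[0, 1]`, so `U` is distributed
like the minimum of `N - 1` of them and `E log U = -(1 + 1/2 + ⋯ + 1/(N - 1))`.

On the other hand `log U = log I_f(X 0, ρ) + d log ρ + log V_d`. Since `ρ → 0` almost surely,
Lebesgue differentiation gives `log I_f(X 0, ρ) → log f(X 0)`. The convergence also holds in mean:
`M_f` and `m_f` control the logarithm for small `ρ`, and for large `ρ` it is bounded below through
`ρ ≤ |X 0 - X 1|`. The points of the sample being exchangeable, the mean of the estimator is
`γ + log (N - 1) - (1 + 1/2 + ⋯ + 1/(N - 1)) - E log I_f(X 0, ρ)`, which tends to `-E log f(X 0)`.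
-/

noncomputable section

namespace KozachenkoLeonenko

section Cdf

variable (ν : Measure ℝ) [IsProbabilityMeasure ν] [NullSingletonClass ν]

lemma continuous_cdf : Continuous (cdf ν) := by
  refine continuous_iff_continuousAt.2 fun a => ?_
  rw [(cdf ν).mono.continuousAt_iff_leftLim_eq_rightLim, (cdf ν).rightLim_eq]
  refine le_antisymm ((cdf ν).mono.leftLim_le le_rfl) ?_
  have h := (cdf ν).measure_singleton a
  rw [measure_cdf, measure_singleton, eq_comm, ENNReal.ofReal_eq_zero] at h
  linarith

lemma measure_le_cdf {s : ℝ} (hs : s ∈ Ioo (0 : ℝ) 1) :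
    ν {t | s ≤ cdf ν t} = ENNReal.ofReal (1 - s) := by
  have hc := continuous_cdf ν
  obtain ⟨a, ha⟩ := ((tendsto_cdf_atBot ν).eventually_lt_const hs.1).exists
  obtain ⟨b, hb⟩ := ((tendsto_cdf_atTop ν).eventually_const_lt hs.2).exists
  obtain ⟨t₀, ht₀⟩ : s ∈ range (cdf ν) :=
    mem_range_of_exists_le_of_exists_ge hc ⟨a, ha.le⟩ ⟨b, hb.le⟩
  have hbdd : BddBelow {t | s ≤ cdf ν t} :=
    ⟨a, fun t ht => ((monotone_cdf ν).reflect_lt (ha.trans_le ht)).le⟩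
  have hmem : s ≤ cdf ν (sInf {t | s ≤ cdf ν t}) :=
    (isClosed_le continuous_const hc).csInf_mem ⟨t₀, ht₀.ge⟩ hbdd
  set r := sInf {t | s ≤ cdf ν t}
  have hIci : {t | s ≤ cdf ν t} = Ici r :=
    Subset.antisymm (fun t ht => csInf_le hbdd ht) fun t ht => hmem.trans (monotone_cdf ν ht)
  have hr : cdf ν r = s :=
    le_antisymm ((monotone_cdf ν (csInf_le hbdd ht₀.ge)).trans_eq ht₀) hmem
  rw [hIci, ← compl_Iio, prob_compl_eq_one_sub measurableSet_Iio, measure_congr Iio_ae_eq_Iic,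
    ← ofReal_cdf, hr, ENNReal.ofReal_sub _ hs.1.le, ENNReal.ofReal_one]

end Cdf

lemma lintegral_exp_neg_mul_one_sub_exp_neg_pow (k : ℕ) :
    ∫⁻ t in Ioi (0 : ℝ), ENNReal.ofReal (Real.exp (-t) * (1 - Real.exp (-t)) ^ k)
      = ENNReal.ofReal ((k + 1 : ℝ)⁻¹) := by
  have hderiv : ∀ t ∈ Ici (0 : ℝ), HasDerivAt
      (fun t : ℝ => (1 - Real.exp (-t)) ^ (k + 1) * (k + 1 : ℝ)⁻¹)
      (Real.exp (-t) * (1 - Real.exp (-t)) ^ k) t := by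
    intro t _
    refine ((((hasDerivAt_neg t).exp.const_sub 1).pow (k + 1)).mul_const _).congr_deriv ?_
    simp only [Nat.add_sub_cancel]
    push_cast
    field_simp
  have hpos : ∀ t ∈ Ioi (0 : ℝ), 0 ≤ Real.exp (-t) * (1 - Real.exp (-t)) ^ k := by
    intro t ht
    have : Real.exp (-t) ≤ 1 := Real.exp_le_one_iff.2 (by linarith [mem_Ioi.1 ht])
    exact mul_nonneg (Real.exp_pos _).le (pow_nonneg (by linarith) _)
  have hlim : Tendsto (fun t : ℝ => (1 - Real.exp (-t)) ^ (k + 1) * (k + 1 : ℝ)⁻¹) atTop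
      (𝓝 ((k + 1 : ℝ)⁻¹)) := by
    simpa using ((Real.tendsto_exp_neg_atTop_nhds_zero.const_sub 1).pow (k + 1)).mul_const
      ((k + 1 : ℝ)⁻¹)
  rw [← ofReal_integral_eq_lintegral_ofReal
    (integrableOn_Ioi_deriv_of_nonneg' hderiv hpos hlim)
    ((ae_restrict_iff' measurableSet_Ioi).2 (Eventually.of_forall hpos)),
    integral_Ioi_of_hasDerivAt_of_nonneg' hderiv hpos hlim]
  simp

lemma harmonic_nonneg (n : ℕ) : (0 : ℝ) ≤ harmonic n := by
  exact_mod_cast Finset.sum_nonneg fun i _ => by positivity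

lemma lintegral_one_sub_one_sub_exp_neg_pow (n : ℕ) :
    ∫⁻ t in Ioi (0 : ℝ), ENNReal.ofReal (1 - (1 - Real.exp (-t)) ^ n)
      = ENNReal.ofReal (harmonic n : ℝ) := by
  induction n with
  | zero => simp
  | succ n ih =>
    have hsplit : ∀ t ∈ Ioi (0 : ℝ), ENNReal.ofReal (1 - (1 - Real.exp (-t)) ^ (n + 1))
        = ENNReal.ofReal (1 - (1 - Real.exp (-t)) ^ n)
          + ENNReal.ofReal (Real.exp (-t) * (1 - Real.exp (-t)) ^ n) := by
      intro t ht
      have h1 : Real.exp (-t) ≤ 1 := Real.exp_le_one_iff.2 (by linarith [mem_Ioi.1 ht])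
      have h0 := Real.exp_pos (-t)
      have h2 : (1 - Real.exp (-t)) ^ n ≤ 1 := pow_le_one₀ (by linarith) (by linarith)
      rw [← ENNReal.ofReal_add (by linarith) (mul_nonneg h0.le (pow_nonneg (by linarith) _))]
      congr 1
      ring
    rw [setLIntegral_congr_fun measurableSet_Ioi hsplit, lintegral_add_left (by fun_prop), ih,
      lintegral_exp_neg_mul_one_sub_exp_neg_pow, ← ENNReal.ofReal_add (harmonic_nonneg n)
      (by positivity), harmonic_succ]
    push_cast
    rfl

/-- `U` is distributed like the minimum of `m` independent uniform random variables on `[0, 1]`.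
The law is recorded by its tails, in the form in which the sample produces them. -/
structure HasMinUniformLaw {Ω : Type*} [MeasurableSpace Ω] (U : Ω → ℝ) (m : ℕ) (P : Measure Ω) :
    Prop where
  measurable : Measurable U
  mem_Icc : ∀ ω, U ω ∈ Icc (0 : ℝ) 1
  measure_ge : ∀ s ∈ Ioo (0 : ℝ) 1, P {ω | s ≤ U ω} = ENNReal.ofReal ((1 - s) ^ m)

namespace HasMinUniformLaw

variable {Ω : Type*} [MeasurableSpace Ω] {P : Measure Ω}

lemma ae_exists_lt {U : ℕ → Ω → ℝ} (h : ∀ n, HasMinUniformLaw (U n) (n + 1) P) :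
    ∀ᵐ ω ∂P, ∀ s > 0, ∃ n, U n ω < s := by
  have of_lt_one : ∀ s ∈ Ioo (0 : ℝ) 1, ∀ᵐ ω ∂P, ∃ n, U n ω < s := by
    intro s hs
    have hle : ∀ n, P {ω | ¬ ∃ n, U n ω < s} ≤ ENNReal.ofReal ((1 - s) ^ (n + 1)) := by
      intro n
      rw [← (h n).measure_ge s hs]
      exact measure_mono fun ω hω => not_lt.1 fun hlt => hω ⟨n, hlt⟩
    have hlim : Tendsto (fun n : ℕ => ENNReal.ofReal ((1 - s) ^ (n + 1))) atTop (𝓝 0) := by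
      simpa using ENNReal.tendsto_ofReal ((tendsto_pow_atTop_nhds_zero_of_lt_one
        (sub_nonneg.2 hs.2.le) (sub_lt_self 1 hs.1)).comp (tendsto_add_atTop_nat 1))
    exact ae_iff.2 (le_antisymm (ge_of_tendsto' hlim hle) zero_le)
  have hall : ∀ᵐ ω ∂P, ∀ k : ℕ, ∃ n, U n ω < 1 / (k + 1 + 1 : ℝ) :=
    ae_all_iff.2 fun k => of_lt_one _
      ⟨by positivity, (div_lt_one (by positivity)).2 (lt_add_of_pos_left 1 (by positivity))⟩
  filter_upwards [hall] with ω hω s hs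
  obtain ⟨k, hk⟩ := exists_nat_one_div_lt hs
  obtain ⟨n, hn⟩ := hω k
  exact ⟨n, hn.trans ((one_div_lt_one_div_of_lt (by positivity) (lt_add_one _)).trans hk)⟩

variable {U : Ω → ℝ} {m : ℕ}

lemma neg_log_nonneg (h : HasMinUniformLaw U m P) (ω : Ω) : 0 ≤ -Real.log (U ω) :=
  neg_nonneg.2 (Real.log_nonpos (h.mem_Icc ω).1 (h.mem_Icc ω).2)

variable [IsProbabilityMeasure P]

lemma ae_pos (h : HasMinUniformLaw U m P) : ∀ᵐ ω ∂P, 0 < U ω := by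
  refine (mem_ae_iff_prob_eq_one (measurableSet_lt measurable_const h.measurable)).2 ?_
  refine le_antisymm prob_le_one ?_
  have hlim : Tendsto (fun s : ℝ => ENNReal.ofReal ((1 - s) ^ m)) (𝓝[>] 0) (𝓝 1) := by
    have hc : Continuous fun s : ℝ => ENNReal.ofReal ((1 - s) ^ m) :=
      ENNReal.continuous_ofReal.comp (by fun_prop)
    simpa using (hc.tendsto 0).mono_left nhdsWithin_le_nhds
  refine le_of_tendsto hlim ?_
  filter_upwards [Ioo_mem_nhdsGT one_pos] with s hs
  rw [← h.measure_ge s hs]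
  exact measure_mono fun ω hω => hs.1.trans_le hω

lemma lintegral_neg_log (h : HasMinUniformLaw U m P) :
    ∫⁻ ω, ENNReal.ofReal (-Real.log (U ω)) ∂P = ENNReal.ofReal (harmonic m : ℝ) := by
  rw [lintegral_eq_lintegral_meas_lt _ (Eventually.of_forall h.neg_log_nonneg)
    h.measurable.log.neg.aemeasurable, ← lintegral_one_sub_one_sub_exp_neg_pow]
  refine setLIntegral_congr_fun measurableSet_Ioi fun t ht => ?_
  have hs : Real.exp (-t) ∈ Ioo (0 : ℝ) 1 :=
    ⟨Real.exp_pos _, Real.exp_lt_one_iff.2 (neg_neg_iff_pos.2 ht)⟩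
  have hae : {ω | t < -Real.log (U ω)} =ᵐ[P] ({ω | Real.exp (-t) ≤ U ω}ᶜ : Set Ω) := by
    filter_upwards [h.ae_pos] with ω hω
    refine propext ?_
    change t < -Real.log (U ω) ↔ ¬ Real.exp (-t) ≤ U ω
    rw [not_le, ← Real.log_lt_iff_lt_exp hω, lt_neg]
  refine (measure_congr hae).trans ?_
  rw [prob_compl_eq_one_sub (measurableSet_le measurable_const h.measurable), h.measure_ge _ hs,
    ENNReal.ofReal_sub _ (pow_nonneg (sub_nonneg.2 hs.2.le) _), ENNReal.ofReal_one]

lemma integrable_log (h : HasMinUniformLaw U m P) : Integrable (fun ω => Real.log (U ω)) P := by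
  rw [← integrable_neg_iff]
  refine (lintegral_ofReal_ne_top_iff_integrable h.measurable.log.neg.aestronglyMeasurable
    (Eventually.of_forall h.neg_log_nonneg)).1 ?_
  exact h.lintegral_neg_log.trans_ne ENNReal.ofReal_ne_top

lemma integral_log (h : HasMinUniformLaw U m P) :
    ∫ ω, Real.log (U ω) ∂P = -(harmonic m : ℝ) := by
  rw [← neg_inj, neg_neg, ← integral_neg, integral_eq_lintegral_of_nonneg_ae
    (Eventually.of_forall h.neg_log_nonneg) h.measurable.log.neg.aestronglyMeasurable,
    h.lintegral_neg_log, ENNReal.toReal_ofReal (harmonic_nonneg m)]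

end HasMinUniformLaw

/-- The positive part `log⁺ a` of the logarithm, with values in `[0, ∞]`, of `a` in `[0, ∞]`. -/
def ennPosLog (a : ℝ≥0∞) : ℝ≥0∞ := (ENNReal.log a).toENNReal

lemma ennPosLog_of_ne_top {a : ℝ≥0∞} (ha : a ≠ ∞) :
    ennPosLog a = ENNReal.ofReal (Real.log a.toReal) := by
  obtain rfl | h0 := eq_or_ne a 0
  · simp [ennPosLog]
  · rw [ennPosLog, ENNReal.log_pos_real h0 ha, EReal.real_coe_toENNReal]

lemma monotone_ennPosLog : Monotone ennPosLog := fun _ _ h =>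
  EReal.toENNReal_le_toENNReal (ENNReal.log_monotone h)

lemma measurable_ennPosLog : Measurable ennPosLog :=
  ENNReal.measurable_log.ereal_toENNReal

lemma ofReal_log_toReal_le (a : ℝ≥0∞) : ENNReal.ofReal (Real.log a.toReal) ≤ ennPosLog a := by
  obtain rfl | ha := eq_or_ne a ∞
  · simp
  · exact (ennPosLog_of_ne_top ha).ge

lemma ofReal_neg_log_toReal_le (a : ℝ≥0∞) :
    ENNReal.ofReal (-Real.log a.toReal) ≤ ennPosLog a⁻¹ := by
  rw [← Real.log_inv, ← ENNReal.toReal_inv]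
  exact ofReal_log_toReal_le a⁻¹

lemma ennPosLog_le_rpow_div (a : ℝ≥0∞) {ε : ℝ} (hε : 0 < ε) :
    ennPosLog a ≤ a ^ ε / ENNReal.ofReal ε := by
  obtain rfl | ha := eq_or_ne a ∞
  · simp [ENNReal.top_rpow_of_pos hε, ENNReal.top_div]
  · rw [ennPosLog_of_ne_top ha, ← ENNReal.ofReal_toReal (ENNReal.rpow_ne_top_of_nonneg hε.le ha),
      ← ENNReal.toReal_rpow, ← ENNReal.ofReal_div_of_pos hε]
    exact ENNReal.ofReal_le_ofReal (Real.log_le_rpow_div ENNReal.toReal_nonneg hε)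

lemma enorm_le_ofReal_add_ofReal_neg (t : ℝ) :
    ‖t‖ₑ ≤ ENNReal.ofReal t + ENNReal.ofReal (-t) := by
  rw [Real.enorm_eq_ofReal_abs]
  obtain h | h := abs_cases t <;> rw [h.1]
  · exact le_self_add
  · exact le_add_self

lemma tendsto_integral_of_enorm_le {α E : Type*} [MeasurableSpace α] {μ : Measure α}
    [NormedAddCommGroup E] [NormedSpace ℝ E] {F : ℕ → α → E} {g : α → E} {B : α → ℝ≥0∞}
    (hF : ∀ n, AEStronglyMeasurable (F n) μ) (hB : AEMeasurable B μ) (hB_int : ∫⁻ a, B a ∂μ ≠ ∞)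
    (hle : ∀ᵐ a ∂μ, ∀ n, ‖F n a‖ₑ ≤ B a)
    (hlim : ∀ᵐ a ∂μ, Tendsto (fun n => F n a) atTop (𝓝 (g a))) :
    (∀ n, Integrable (F n) μ) ∧ Integrable g μ ∧
      Tendsto (fun n => ∫ a, F n a ∂μ) atTop (𝓝 (∫ a, g a ∂μ)) := by
  have integrable_of_le : ∀ {u : α → E}, AEStronglyMeasurable u μ → (∀ᵐ a ∂μ, ‖u a‖ₑ ≤ B a) →
      Integrable u μ := fun hu h => ⟨hu, (lintegral_mono_ae h).trans_lt hB_int.lt_top⟩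
  refine ⟨fun n => integrable_of_le (hF n) (hle.mono fun a h => h n),
    integrable_of_le (aestronglyMeasurable_of_tendsto_ae atTop hF hlim) ?_, ?_⟩
  · filter_upwards [hle, hlim] with a h h'
    exact le_of_tendsto' h'.enorm h
  · refine tendsto_integral_of_dominated_convergence (fun a => (B a).toReal) hF
      (integrable_toReal_of_lintegral_ne_top hB hB_int) (fun n => ?_) hlim
    filter_upwards [hle, ae_lt_top' hB hB_int] with a h h'
    rw [← toReal_enorm]
    exact ENNReal.toReal_mono h'.ne (h n)

section CountableRadii

variable {α : Type*} [CompleteLinearOrder α] [TopologicalSpace α] [OrderTopology α] {g : ℝ → α}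
  {a b : ℝ}

lemma biSup_Ioc_eq_of_continuousWithinAt (hg : ∀ r ∈ Ioc a b, ContinuousWithinAt g (Ioi r) r) :
    ⨆ r ∈ Ioc a b, g r = ⨆ r ∈ Ioc a b ∩ insert b (range ((↑) : ℚ → ℝ)), g r := by
  refine le_antisymm (iSup₂_le fun r hr => ?_) (biSup_mono fun r hr => hr.1)
  obtain rfl | hrb := hr.2.eq_or_lt
  · exact le_biSup g ⟨hr, mem_insert _ _⟩
  refine le_of_tendsto_of_frequently (hg r hr) ?_
  refine (nhdsGT_basis r).frequently_iff.2 fun c hc => ?_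
  obtain ⟨q, hrq, hq⟩ := exists_rat_btwn (lt_min hrb hc)
  refine ⟨q, ⟨hrq, hq.trans_le (min_le_right _ _)⟩, le_biSup g ⟨⟨hr.1.trans hrq, ?_⟩, ?_⟩⟩
  · exact hq.le.trans (min_le_left _ _)
  · exact mem_insert_of_mem _ (mem_range_self q)

lemma biInf_Ioc_eq_of_continuousWithinAt (hg : ∀ r ∈ Ioc a b, ContinuousWithinAt g (Ioi r) r) :
    ⨅ r ∈ Ioc a b, g r = ⨅ r ∈ Ioc a b ∩ insert b (range ((↑) : ℚ → ℝ)), g r :=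
  biSup_Ioc_eq_of_continuousWithinAt (α := αᵒᵈ) hg

lemma countable_Ioc_inter_insert_range_ratCast (a b : ℝ) :
    (Ioc a b ∩ insert b (range ((↑) : ℚ → ℝ))).Countable :=
  ((countable_range _).insert b).mono inter_subset_right

end CountableRadii

section Balls

variable {E : Type*} [PseudoMetricSpace E] [MeasurableSpace E] (μ : Measure E)

lemma measureReal_closedBall_pos [IsFiniteMeasure μ] {x : E} (hx : x ∈ μ.support) {r : ℝ}
    (hr : 0 < r) : 0 < μ.real (Metric.closedBall x r) :=
  ENNReal.toReal_pos
    ((Measure.mem_support_iff_forall x).1 hx _ (Metric.closedBall_mem_nhds x hr)).ne'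
    (measure_ne_top _ _)

variable [OpensMeasurableSpace E]

lemma continuousWithinAt_Ioi_measure_closedBall [IsFiniteMeasure μ] (x : E) (r : ℝ) :
    ContinuousWithinAt (fun r => μ (Metric.closedBall x r)) (Ioi r) r := by
  have hInter : ⋂ s > r, Metric.closedBall x s = Metric.closedBall x r := by
    ext y
    simp only [gt_iff_lt, mem_iInter, Metric.mem_closedBall]
    exact ⟨le_of_forall_gt_imp_ge_of_dense, fun h s hs => h.trans hs.le⟩
  have h := tendsto_measure_biInter_gt (μ := μ) (s := Metric.closedBall x) (a := r)
    (fun s _ => Metric.isClosed_closedBall.nullMeasurableSet)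
    (fun _ _ _ h => Metric.closedBall_subset_closedBall h)
    ⟨r + 1, lt_add_one r, measure_ne_top _ _⟩
  rwa [hInter] at h

lemma measure_le_measureReal_closedBall_dist [IsProbabilityMeasure μ] {x : E}
    (hμ : ∀ r, μ (Metric.sphere x r) = 0) {s : ℝ} (hs : s ∈ Ioo (0 : ℝ) 1) :
    μ {y | s ≤ μ.real (Metric.closedBall x (dist y x))} = ENNReal.ofReal (1 - s) := by
  have hm : Measurable fun y => dist y x := (continuous_id.dist continuous_const).measurable
  have : IsProbabilityMeasure (μ.map fun y => dist y x) :=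
    Measure.isProbabilityMeasure_map hm.aemeasurable
  have : NullSingletonClass (μ.map fun y => dist y x) :=
    ⟨fun r => by rw [Measure.map_apply hm (measurableSet_singleton r)]; exact hμ r⟩
  have hcdf : ∀ r, cdf (μ.map fun y => dist y x) r = μ.real (Metric.closedBall x r) := by
    intro r
    rw [cdf_eq_real, map_measureReal_apply hm measurableSet_Iic]
    rfl
  rw [← measure_le_cdf (μ.map fun y => dist y x) hs, Measure.map_apply hm
    (measurableSet_le measurable_const (monotone_cdf _).measurable)]
  simp only [hcdf, preimage_ofPred_eq]

variable [SecondCountableTopology E] [SFinite μ] {α : Type*} [MeasurableSpace α] {c : α → E}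
  {r : α → ℝ}

lemma measurable_measure_closedBall (hc : Measurable c) (hr : Measurable r) :
    Measurable fun a => μ (Metric.closedBall (c a) (r a)) := by
  have h : MeasurableSet {q : α × E | dist q.2 (c q.1) ≤ r q.1} :=
    measurableSet_le (measurable_snd.dist (hc.comp measurable_fst)) (hr.comp measurable_fst)
  exact measurable_measure_prodMk_left h

lemma measurable_measureReal_closedBall (hc : Measurable c) (hr : Measurable r) :
    Measurable fun a => μ.real (Metric.closedBall (c a) (r a)) :=
  (measurable_measure_closedBall μ hc hr).ennreal_toReal

end Balls

/-- The measure on `ℝ^d` with density `f`. -/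
abbrev densityMeasure {d : ℕ} (f : EuclideanSpace ℝ (Fin d) → ℝ) :
    Measure (EuclideanSpace ℝ (Fin d)) :=
  volume.withDensity fun x => ENNReal.ofReal (f x)

lemma unitBallVolume_pos (d : ℕ) : 0 < unitBallVolume d :=
  div_pos (Real.rpow_pos_of_pos Real.pi_pos _) (Real.Gamma_pos_of_pos (by positivity))

section Density

variable {d : ℕ} {f : EuclideanSpace ℝ (Fin d) → ℝ} {x : EuclideanSpace ℝ (Fin d)} {r R : ℝ}

lemma volume_closedBall_eq_unitBallVolume (hd : 1 ≤ d) (x : EuclideanSpace ℝ (Fin d))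
    (hr : 0 ≤ r) : volume (Metric.closedBall x r) = ENNReal.ofReal (r ^ d * unitBallVolume d) := by
  have : Nonempty (Fin d) := ⟨⟨0, hd⟩⟩
  rw [EuclideanSpace.volume_closedBall, Fintype.card_fin, ← ENNReal.ofReal_pow hr,
    ← ENNReal.ofReal_mul (pow_nonneg hr d), unitBallVolume, Real.sqrt_eq_rpow,
    ← Real.rpow_natCast (Real.pi ^ (1 / 2 : ℝ)) d, ← Real.rpow_mul Real.pi_pos.le]
  congr 4
  ring

lemma densityMeasure_sphere (hd : 1 ≤ d) (f : EuclideanSpace ℝ (Fin d) → ℝ)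
    (x : EuclideanSpace ℝ (Fin d)) (r : ℝ) : densityMeasure f (Metric.sphere x r) = 0 := by
  have : Nonempty (Fin d) := ⟨⟨0, hd⟩⟩
  exact withDensity_absolutelyContinuous _ _ (Measure.addHaar_sphere volume x r)

lemma lintegral_mul_ofReal_density (hf : Measurable f)
    {g : EuclideanSpace ℝ (Fin d) → ℝ≥0∞} (hg : Measurable g) :
    ∫⁻ x, g x * ENNReal.ofReal (f x) = ∫⁻ x, g x ∂densityMeasure f := by
  rw [lintegral_withDensity_eq_lintegral_mul _ hf.ennreal_ofReal hg]
  exact lintegral_congr fun x => mul_comm _ _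

lemma integrable_densityMeasure_iff (hf : Measurable f) (hf0 : ∀ x, 0 ≤ f x)
    {g : EuclideanSpace ℝ (Fin d) → ℝ} :
    Integrable g (densityMeasure f) ↔ Integrable (fun x => f x * g x) := by
  rw [integrable_withDensity_iff_integrable_smul' hf.ennreal_ofReal (by simp)]
  simp only [ENNReal.toReal_ofReal (hf0 _), smul_eq_mul]

lemma integral_log_densityMeasure (hf : Measurable f) (hf0 : ∀ x, 0 ≤ f x) :
    ∫ x, Real.log (f x) ∂densityMeasure f = -entropy f := by
  rw [integral_withDensity_eq_integral_toReal_smul hf.ennreal_ofReal (by simp), entropy, neg_neg]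
  simp only [ENNReal.toReal_ofReal (hf0 _), smul_eq_mul]

lemma ae_density_pos (hf : Measurable f) : ∀ᵐ x ∂densityMeasure f, 0 < f x :=
  (ae_withDensity_iff hf.ennreal_ofReal).2 <| Eventually.of_forall fun _ h =>
    ENNReal.ofReal_pos.1 (pos_iff_ne_zero.2 h)

lemma ballMean_eq_div (f : EuclideanSpace ℝ (Fin d) → ℝ) (x : EuclideanSpace ℝ (Fin d)) (r : ℝ) :
    ballMean f x r
      = densityMeasure f (Metric.closedBall x r) / ENNReal.ofReal (r ^ d * unitBallVolume d) := by
  rw [ballMean, withDensity_apply _ Metric.isClosed_closedBall.measurableSet]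

lemma ballMean_le_localMax (hr : r ∈ Ioc 0 R) : ballMean f x r ≤ localMax f x R :=
  le_biSup (ballMean f x) hr

lemma localMin_le_ballMean (hr : r ∈ Ioc 0 R) : localMin f x R ≤ ballMean f x r :=
  biInf_le (ballMean f x) hr

lemma measurable_ballMean {α : Type*} [MeasurableSpace α] {c : α → EuclideanSpace ℝ (Fin d)}
    {r : α → ℝ} (hc : Measurable c) (hr : Measurable r) :
    Measurable fun a => ballMean f (c a) (r a) := by
  simp only [ballMean_eq_div]
  exact (measurable_measure_closedBall _ hc hr).div
    ((hr.pow_const d).mul_const _).ennreal_ofReal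

section IsFiniteMeasure

variable [IsFiniteMeasure (densityMeasure f)]

lemma ae_tendsto_log_toReal_ballMean (hd : 1 ≤ d) (hf : Measurable f) :
    ∀ᵐ x ∂densityMeasure f,
      Tendsto (fun r => Real.log (ballMean f x r).toReal) (𝓝[>] 0) (𝓝 (Real.log (f x))) := by
  have hdiff : ∀ᵐ x ∂densityMeasure f,
      Tendsto (ballMean f x) (𝓝[>] 0) (𝓝 (ENNReal.ofReal (f x))) := by
    refine (withDensity_absolutelyContinuous _ _).ae_le ?_
    filter_upwards [Besicovitch.ae_tendsto_rnDeriv (densityMeasure f) volume,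
      Measure.rnDeriv_withDensity volume hf.ennreal_ofReal] with x hx hx'
    rw [hx'] at hx
    refine hx.congr' ?_
    filter_upwards [self_mem_nhdsWithin] with r hr
    rw [volume_closedBall_eq_unitBallVolume hd x (mem_Ioi.1 hr).le, ← ballMean_eq_div]
  filter_upwards [hdiff, ae_density_pos hf] with x hx hpos
  have h := (ENNReal.tendsto_toReal ENNReal.ofReal_ne_top).comp hx
  rw [ENNReal.toReal_ofReal hpos.le] at h
  exact h.log hpos.ne'

lemma continuousWithinAt_Ioi_ballMean (x : EuclideanSpace ℝ (Fin d)) (hr : 0 < r) :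
    ContinuousWithinAt (ballMean f x) (Ioi r) r := by
  have hV : 0 < r ^ d * unitBallVolume d := mul_pos (pow_pos hr d) (unitBallVolume_pos d)
  have hden : Continuous fun r : ℝ => ENNReal.ofReal (r ^ d * unitBallVolume d) :=
    ENNReal.continuous_ofReal.comp (by fun_prop)
  rw [funext (ballMean_eq_div f x)]
  exact ENNReal.Tendsto.div (continuousWithinAt_Ioi_measure_closedBall _ x r)
    (Or.inr (ENNReal.ofReal_pos.2 hV).ne') hden.continuousWithinAt (Or.inl ENNReal.ofReal_ne_top)

lemma measurable_localMax (R : ℝ) : Measurable fun x => localMax f x R := by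
  simp only [localMax, fun x => biSup_Ioc_eq_of_continuousWithinAt (b := R)
    fun _ hr => continuousWithinAt_Ioi_ballMean (f := f) x (mem_Ioc.1 hr).1]
  exact .biSup _ (countable_Ioc_inter_insert_range_ratCast 0 R) fun _ _ =>
    measurable_ballMean measurable_id measurable_const

lemma measurable_localMin (R : ℝ) : Measurable fun x => localMin f x R := by
  simp only [localMin, fun x => biInf_Ioc_eq_of_continuousWithinAt (b := R)
    fun _ hr => continuousWithinAt_Ioi_ballMean (f := f) x (mem_Ioc.1 hr).1]
  exact .biInf _ (countable_Ioc_inter_insert_range_ratCast 0 R) fun _ _ =>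
    measurable_ballMean measurable_id measurable_const

lemma log_toReal_ballMean (hx : x ∈ (densityMeasure f).support) (hr : 0 < r) :
    Real.log (ballMean f x r).toReal = Real.log ((densityMeasure f).real (Metric.closedBall x r))
      - (d * Real.log r + Real.log (unitBallVolume d)) := by
  have hV := unitBallVolume_pos d
  have hB := measureReal_closedBall_pos (densityMeasure f) hx hr
  rw [ballMean_eq_div, ENNReal.toReal_div, ENNReal.toReal_ofReal (by positivity), ← measureReal_def,
    Real.log_div hB.ne' (by positivity), Real.log_mul (by positivity) hV.ne', Real.log_pow]

lemma ofReal_neg_log_ballMean_le (hx : x ∈ (densityMeasure f).support) (hR : 0 < R) {D : ℝ}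
    (hr : 0 < r) (hrD : r ≤ D) :
    ENNReal.ofReal (-Real.log (ballMean f x r).toReal)
      ≤ ennPosLog (localMin f x R)⁻¹ + ENNReal.ofReal (d * (|Real.log R| + Real.posLog D)) := by
  have le_localMin : ∀ s ∈ Ioc 0 R, ENNReal.ofReal (-Real.log (ballMean f x s).toReal)
      ≤ ennPosLog (localMin f x R)⁻¹ := fun s hs =>
    (ofReal_neg_log_toReal_le _).trans
      (monotone_ennPosLog (ENNReal.inv_le_inv.2 (localMin_le_ballMean hs)))
  obtain hrR | hRr := le_or_gt r R
  · exact (le_localMin r ⟨hr, hrR⟩).trans le_self_add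
  refine le_trans ?_ (add_le_add_left (le_localMin R ⟨hR, le_rfl⟩) _)
  refine le_trans (ENNReal.ofReal_le_ofReal ?_) ENNReal.ofReal_add_le
  have hball : Real.log ((densityMeasure f).real (Metric.closedBall x R))
      ≤ Real.log ((densityMeasure f).real (Metric.closedBall x r)) :=
    Real.log_le_log (measureReal_closedBall_pos _ hx hR)
      (measureReal_mono (Metric.closedBall_subset_closedBall hRr.le))
  have hlog : Real.log r - Real.log R ≤ |Real.log R| + Real.posLog D := by
    have := Real.log_le_log hr hrD
    have : Real.log D ≤ Real.posLog D := le_max_right _ _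
    have := neg_le_abs (Real.log R)
    linarith
  have := mul_le_mul_of_nonneg_left hlog (Nat.cast_nonneg (α := ℝ) d)
  rw [log_toReal_ballMean hx hr, log_toReal_ballMean hx hR]
  linarith

end IsFiniteMeasure

lemma ofReal_log_ballMean_le [IsProbabilityMeasure (densityMeasure f)]
    (hx : x ∈ (densityMeasure f).support) (hR : 0 < R) (hr : 0 < r) :
    ENNReal.ofReal (Real.log (ballMean f x r).toReal)
      ≤ ennPosLog (localMax f x R)
        + ENNReal.ofReal |d * Real.log R + Real.log (unitBallVolume d)| := by
  obtain hrR | hRr := le_or_gt r R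
  · exact ((ofReal_log_toReal_le _).trans
      (monotone_ennPosLog (ballMean_le_localMax ⟨hr, hrR⟩))).trans le_self_add
  · refine le_trans (ENNReal.ofReal_le_ofReal ?_) le_add_self
    have hball : Real.log ((densityMeasure f).real (Metric.closedBall x r)) ≤ 0 :=
      Real.log_nonpos measureReal_nonneg measureReal_le_one
    have hlog : d * Real.log R ≤ d * Real.log r := by gcongr
    rw [log_toReal_ballMean hx hr]
    linarith [neg_le_abs (d * Real.log R + Real.log (unitBallVolume d))]

end Density

section LogMoments

variable {d : ℕ} {f : EuclideanSpace ℝ (Fin d) → ℝ} {R₁ R₂ : ℝ}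

/-- The conditions on the density `f` under which the estimator converges in mean: `log⁺ |X|`,
`log⁺ M_f(X, R₁)` and `log⁺ (1 / m_f(X, R₂))` have finite mean when `X` has density `f`. -/
structure HasLogMoments (f : EuclideanSpace ℝ (Fin d) → ℝ) (R₁ R₂ : ℝ) : Prop where
  norm : ∫⁻ x, ENNReal.ofReal (Real.posLog ‖x‖) * ENNReal.ofReal (f x) < ∞
  localMax : ∫⁻ x, ennPosLog (localMax f x R₁) * ENNReal.ofReal (f x) < ∞
  localMin : ∫⁻ x, ennPosLog (localMin f x R₂)⁻¹ * ENNReal.ofReal (f x) < ∞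

lemma lintegral_ennPosLog_mul_lt_top {α : Type*} [MeasurableSpace α] {ν : Measure α}
    {a w : α → ℝ≥0∞} {ε : ℝ} (hε : 0 < ε) (h : ∫⁻ x, a x ^ ε * w x ∂ν < ∞) :
    ∫⁻ x, ennPosLog (a x) * w x ∂ν < ∞ :=
  calc ∫⁻ x, ennPosLog (a x) * w x ∂ν
      ≤ ∫⁻ x, (ENNReal.ofReal ε)⁻¹ * (a x ^ ε * w x) ∂ν := by
        refine lintegral_mono fun x => ?_
        rw [← mul_assoc, mul_comm (ENNReal.ofReal ε)⁻¹, ← div_eq_mul_inv]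
        gcongr
        exact ennPosLog_le_rpow_div (a x) hε
    _ = (ENNReal.ofReal ε)⁻¹ * ∫⁻ x, a x ^ ε * w x ∂ν :=
        lintegral_const_mul' _ _ (by simpa using hε)
    _ < ∞ := ENNReal.mul_lt_top (by simpa using hε) h

lemma le_one_add_G (t : ℝ) : t ≤ 1 + G t := by
  unfold G
  split_ifs with h
  · linarith
  · have ht : 0 < t := by linarith
    have hlog := mul_le_mul_of_nonneg_left (Real.one_sub_inv_le_log_of_pos ht) ht.le
    rw [mul_sub, mul_inv_cancel₀ ht.ne'] at hlog
    linarith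

lemma measurable_G : Measurable G :=
  Measurable.ite measurableSet_Iio measurable_const (measurable_id.mul Real.measurable_log)

lemma posLog_norm_le_G {E : Type*} [SeminormedAddCommGroup E] (x y : E) :
    Real.posLog ‖y‖ ≤ Real.posLog ‖x‖ + Real.log 2 + 1 + G |Real.log (dist x y)| := by
  have htri : Real.posLog ‖y‖ ≤ Real.log 2 + Real.posLog ‖x‖ + Real.posLog (dist x y) :=
    calc Real.posLog ‖y‖ ≤ Real.posLog (‖x‖ + dist x y) :=
          Real.posLog_le_posLog (norm_nonneg y)
            (dist_eq_norm x y ▸ norm_le_norm_add_norm_sub x y)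
      _ ≤ _ := Real.posLog_add
  have hG := le_one_add_G |Real.log (dist x y)|
  have habs : Real.posLog (dist x y) ≤ |Real.log (dist x y)| :=
    max_le (abs_nonneg _) (le_abs_self _)
  linarith

lemma exists_lintegral_G_lt_top [IsProbabilityMeasure (densityMeasure f)] (hf : Measurable f)
    {ε : ℝ} (hε : 0 < 1 + ε) (hK : K f ε < ∞) :
    ∃ x, ∫⁻ y, ENNReal.ofReal (G |Real.log (dist x y)|) ∂densityMeasure f < ∞ := by
  set g : EuclideanSpace ℝ (Fin d) → EuclideanSpace ℝ (Fin d) → ℝ≥0∞ :=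
    fun x y => ENNReal.ofReal (G |Real.log (dist x y)|)
  have hg : Measurable (Function.uncurry g) :=
    (measurable_G.comp (measurable_fst.dist measurable_snd).log.abs).ennreal_ofReal
  have hinner : Measurable fun x => (∫⁻ y, g x y ∂densityMeasure f) ^ (1 + ε) :=
    hg.lintegral_prod_right.pow_const _
  have hK' : ∫⁻ x, (∫⁻ y, g x y ∂densityMeasure f) ^ (1 + ε) ∂densityMeasure f < ∞ := by
    rw [← lintegral_mul_ofReal_density hf hinner]
    simpa only [K, ← lintegral_mul_ofReal_density hf hg.of_uncurry_left] using hK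
  obtain ⟨x, hx⟩ := (ae_lt_top hinner hK'.ne).exists
  refine ⟨x, lt_top_iff_ne_top.2 fun htop => hx.ne ?_⟩
  rw [htop, ENNReal.top_rpow_of_pos hε]

lemma lintegral_posLog_norm_lt_top [IsProbabilityMeasure (densityMeasure f)] (hf : Measurable f)
    {ε : ℝ} (hε : 0 < 1 + ε) (hK : K f ε < ∞) :
    ∫⁻ y, ENNReal.ofReal (Real.posLog ‖y‖) * ENNReal.ofReal (f y) < ∞ := by
  obtain ⟨x, hx⟩ := exists_lintegral_G_lt_top hf hε hK
  rw [lintegral_mul_ofReal_density hf (by fun_prop)]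
  calc ∫⁻ y, ENNReal.ofReal (Real.posLog ‖y‖) ∂densityMeasure f
      ≤ ∫⁻ y, (ENNReal.ofReal (Real.posLog ‖x‖ + Real.log 2 + 1)
          + ENNReal.ofReal (G |Real.log (dist x y)|)) ∂densityMeasure f :=
        lintegral_mono fun y => (ENNReal.ofReal_le_ofReal (posLog_norm_le_G x y)).trans
          ENNReal.ofReal_add_le
    _ < ∞ := by
        rw [lintegral_add_left measurable_const, lintegral_const, measure_univ, mul_one]
        exact ENNReal.add_lt_top.2 ⟨ENNReal.ofReal_lt_top, hx⟩

lemma hasLogMoments_of_lt_top [IsProbabilityMeasure (densityMeasure f)] (hf : Measurable f)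
    {ε₀ ε₁ ε₂ : ℝ} (hε₀ : 0 < ε₀) (hε₁ : 0 < ε₁) (hε₂ : 0 < ε₂)
    (hK : K f ε₀ < ∞) (hQ : Q f ε₁ R₁ < ∞) (hT : T f ε₂ R₂ < ∞) : HasLogMoments f R₁ R₂ where
  norm := lintegral_posLog_norm_lt_top hf (by positivity) hK
  localMax := lintegral_ennPosLog_mul_lt_top hε₁ hQ
  localMin := by
    refine lintegral_ennPosLog_mul_lt_top hε₂ ?_
    simpa only [T, ENNReal.inv_rpow, ENNReal.rpow_neg] using hT

/-- A bound for `|log I_f(x, r)|` that is uniform in the radii `0 < r ≤ dist x y`, in particular in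
the nearest-neighbour distances of `x` in the samples that contain `y`. -/
def logBallMeanBound (f : EuclideanSpace ℝ (Fin d) → ℝ) (R₁ R₂ : ℝ)
    (x y : EuclideanSpace ℝ (Fin d)) : ℝ≥0∞ :=
  ennPosLog (localMax f x R₁) + ENNReal.ofReal |d * Real.log R₁ + Real.log (unitBallVolume d)|
    + (ennPosLog (localMin f x R₂)⁻¹
      + ENNReal.ofReal (d * (|Real.log R₂| + Real.posLog (dist x y))))

lemma logBallMeanBound_le (f : EuclideanSpace ℝ (Fin d) → ℝ) (R₁ R₂ : ℝ)
    (x y : EuclideanSpace ℝ (Fin d)) :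
    logBallMeanBound f R₁ R₂ x y ≤ ennPosLog (localMax f x R₁) + ennPosLog (localMin f x R₂)⁻¹
      + d * (ENNReal.ofReal (Real.posLog ‖x‖) + ENNReal.ofReal (Real.posLog ‖y‖))
      + (ENNReal.ofReal |d * Real.log R₁ + Real.log (unitBallVolume d)|
        + d * ENNReal.ofReal (|Real.log R₂| + Real.log 2)) := by
  have hdist : ENNReal.ofReal (d * (|Real.log R₂| + Real.posLog (dist x y)))
      ≤ d * (ENNReal.ofReal (Real.posLog ‖x‖) + ENNReal.ofReal (Real.posLog ‖y‖))
        + d * ENNReal.ofReal (|Real.log R₂| + Real.log 2) := by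
    rw [ENNReal.ofReal_mul d.cast_nonneg, ENNReal.ofReal_natCast, ← mul_add,
      ← ENNReal.ofReal_add Real.posLog_nonneg Real.posLog_nonneg,
      ← ENNReal.ofReal_add (add_nonneg Real.posLog_nonneg Real.posLog_nonneg) (by positivity)]
    refine mul_le_mul_right (ENNReal.ofReal_le_ofReal ?_) _
    have h := Real.posLog_norm_add_le x (-y)
    rw [norm_neg, ← sub_eq_add_neg, ← dist_eq_norm] at h
    linarith
  refine (add_le_add_right (add_le_add_right hdist _) _).trans_eq ?_
  ring

lemma measurable_logBallMeanBound [IsFiniteMeasure (densityMeasure f)] (R₁ R₂ : ℝ) :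
    Measurable fun p : EuclideanSpace ℝ (Fin d) × EuclideanSpace ℝ (Fin d) =>
      logBallMeanBound f R₁ R₂ p.1 p.2 :=
  ((measurable_ennPosLog.comp ((measurable_localMax R₁).comp measurable_fst)).add_const _).add
    ((measurable_ennPosLog.comp ((measurable_localMin R₂).comp measurable_fst).inv).add
      (((Real.continuous_posLog.measurable.comp
        (measurable_fst.dist measurable_snd)).const_add _).const_mul _).ennreal_ofReal)

lemma enorm_log_ballMean_le [IsProbabilityMeasure (densityMeasure f)]
    {x y : EuclideanSpace ℝ (Fin d)} (hx : x ∈ (densityMeasure f).support) (hR₁ : 0 < R₁)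
    (hR₂ : 0 < R₂) {r : ℝ} (hr : 0 < r) (hry : r ≤ dist x y) :
    ‖Real.log (ballMean f x r).toReal‖ₑ ≤ logBallMeanBound f R₁ R₂ x y :=
  (enorm_le_ofReal_add_ofReal_neg _).trans
    (add_le_add (ofReal_log_ballMean_le hx hR₁ hr) (ofReal_neg_log_ballMean_le hx hR₂ hr hry))

end LogMoments

lemma pi_measure_forall_mem {E : Type*} [MeasurableSpace E] (μ : Measure E)
    [IsProbabilityMeasure μ] (n : ℕ) {S : Set (E × E)} (hS : MeasurableSet S) :
    Measure.pi (fun _ : Fin (n + 1) => μ) {x | ∀ j : Fin n, (x 0, x j.succ) ∈ S}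
      = ∫⁻ a, μ (Prod.mk a ⁻¹' S) ^ n ∂μ := by
  have hT : MeasurableSet {p : E × (Fin n → E) | ∀ j : Fin n, (p.1, p.2 j) ∈ S} :=
    measurableSet_setOfPred.2 <| .forall fun j => measurableSet_setOfPred.1 <|
      (show Measurable fun p : E × (Fin n → E) => (p.1, p.2 j) by fun_prop) hS
  calc Measure.pi (fun _ : Fin (n + 1) => μ) {x | ∀ j : Fin n, (x 0, x j.succ) ∈ S}
      = (μ.prod (Measure.pi fun _ : Fin n => μ))
          {p : E × (Fin n → E) | ∀ j : Fin n, (p.1, p.2 j) ∈ S} :=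
        (measurePreserving_piFinSuccAbove (fun _ : Fin (n + 1) => μ) 0).measure_preimage
          hT.nullMeasurableSet
    _ = ∫⁻ a, Measure.pi (fun _ : Fin n => μ) (univ.pi fun _ => Prod.mk a ⁻¹' S) ∂μ := by
        rw [Measure.prod_apply hT]
        refine lintegral_congr fun a => congrArg _ ?_
        ext
        simp
    _ = ∫⁻ a, μ (Prod.mk a ⁻¹' S) ^ n ∂μ := by simp [Measure.pi_pi]

section NearestNeighbour

variable {d N n : ℕ}

lemma nnDist_le (x : Fin N → EuclideanSpace ℝ (Fin d)) {i j : Fin N} (h : j ≠ i) :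
    nnDist x i ≤ dist (x i) (x j) :=
  ciInf_le (Set.finite_range _).bddBelow (⟨j, h⟩ : {j : Fin N // j ≠ i})

lemma nnDist_nonneg (x : Fin N → EuclideanSpace ℝ (Fin d)) (i : Fin N) : 0 ≤ nnDist x i :=
  Real.iInf_nonneg fun _ => dist_nonneg

lemma exists_nnDist_eq_dist (x : Fin (n + 2) → EuclideanSpace ℝ (Fin d)) (i : Fin (n + 2)) :
    ∃ j ≠ i, nnDist x i = dist (x i) (x j) := by
  obtain ⟨j, hj⟩ := exists_ne i
  have : Nonempty {j : Fin (n + 2) // j ≠ i} := ⟨⟨j, hj⟩⟩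
  obtain ⟨⟨k, hk⟩, h⟩ :=
    exists_eq_ciInf_of_finite (f := fun j : {j : Fin (n + 2) // j ≠ i} => dist (x i) (x j))
  exact ⟨k, hk, h.symm⟩

lemma measurable_nnDist (i : Fin N) :
    Measurable fun x : Fin N → EuclideanSpace ℝ (Fin d) => nnDist x i :=
  Measurable.iInf fun j => (measurable_pi_apply i).dist (measurable_pi_apply j.1)

lemma nnDist_comp_perm (x : Fin N → EuclideanSpace ℝ (Fin d)) (σ : Equiv.Perm (Fin N))
    (i : Fin N) : nnDist (fun j => x (σ j)) i = nnDist x (σ i) :=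
  (σ.subtypeEquiv fun j => by simp : {j // j ≠ i} ≃ {j // j ≠ σ i}).iInf_congr fun _ => rfl

lemma antitone_nnDist_zero (x : ℕ → EuclideanSpace ℝ (Fin d)) :
    Antitone fun n : ℕ => nnDist (fun i : Fin (n + 2) => x i) 0 := by
  intro m n hmn
  obtain ⟨j, hj, h⟩ := exists_nnDist_eq_dist (fun i : Fin (m + 2) => x i) 0
  simp only [h]
  exact nnDist_le (fun i : Fin (n + 2) => x i) (i := 0) (j := Fin.castLE (by omega) j)
    (fun h => hj (Fin.ext (by simpa using congrArg Fin.val h)))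

lemma log_nnGeomMean {x : Fin N → EuclideanSpace ℝ (Fin d)} (hx : ∀ i, 0 < nnDist x i) :
    Real.log (nnGeomMean x) = 1 / (N : ℝ) * ∑ i, Real.log (nnDist x i) := by
  rw [nnGeomMean, Real.log_rpow (Finset.prod_pos fun i _ => hx i),
    Real.log_prod fun i _ => (hx i).ne']

/-- The `μ`-probability of the ball around the first point of the sample that reaches its nearest
neighbour. -/
def nnBallProb (μ : Measure (EuclideanSpace ℝ (Fin d)))
    (x : Fin (N + 1) → EuclideanSpace ℝ (Fin d)) : ℝ :=
  μ.real (Metric.closedBall (x 0) (nnDist x 0))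

variable (μ : Measure (EuclideanSpace ℝ (Fin d)))

lemma measurable_nnBallProb [SFinite μ] : Measurable (nnBallProb (N := N) μ) :=
  measurable_measureReal_closedBall μ (measurable_pi_apply 0) (measurable_nnDist 0)

lemma le_nnBallProb_iff [IsFiniteMeasure μ] (x : Fin (n + 2) → EuclideanSpace ℝ (Fin d)) (s : ℝ) :
    s ≤ nnBallProb μ x ↔
      ∀ j : Fin (n + 1), s ≤ μ.real (Metric.closedBall (x 0) (dist (x j.succ) (x 0))) := by
  constructor
  · intro h j
    refine h.trans (measureReal_mono (Metric.closedBall_subset_closedBall ?_))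
    rw [dist_comm]
    exact nnDist_le x (Fin.succ_ne_zero j)
  · intro h
    obtain ⟨j, hj, hdist⟩ := exists_nnDist_eq_dist x 0
    obtain ⟨k, rfl⟩ := Fin.exists_succ_eq.2 hj
    rw [nnBallProb, hdist, dist_comm]
    exact h k

lemma pi_le_nnBallProb [IsProbabilityMeasure μ] (hμ : ∀ x r, μ (Metric.sphere x r) = 0) {s : ℝ}
    (hs : s ∈ Ioo (0 : ℝ) 1) :
    Measure.pi (fun _ : Fin (n + 2) => μ) {x | s ≤ nnBallProb μ x}
      = ENNReal.ofReal ((1 - s) ^ (n + 1)) := by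
  have hS : MeasurableSet {p : EuclideanSpace ℝ (Fin d) × EuclideanSpace ℝ (Fin d) |
      s ≤ μ.real (Metric.closedBall p.1 (dist p.2 p.1))} :=
    measurableSet_le measurable_const
      (measurable_measureReal_closedBall μ measurable_fst (measurable_snd.dist measurable_fst))
  simp only [le_nnBallProb_iff]
  refine (pi_measure_forall_mem μ (n + 1) hS).trans ?_
  simp only [preimage_ofPred_eq, measure_le_measureReal_closedBall_dist μ (hμ _) hs]
  rw [lintegral_const, measure_univ, mul_one, ENNReal.ofReal_pow (sub_nonneg.2 hs.2.le)]

end NearestNeighbour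

/-- The random points `X 0, X 1, …` are independent with common law `μ`. -/
structure IsIIDSample {Ω E : Type*} [MeasurableSpace Ω] [MeasurableSpace E] (X : ℕ → Ω → E)
    (μ : Measure E) (P : Measure Ω) : Prop where
  measurable : ∀ i, Measurable (X i)
  indep : iIndepFun X P
  map_eq : ∀ i, P.map (X i) = μ

/-- The sample of the first `N` observations. -/
abbrev sample {Ω E : Type*} (X : ℕ → Ω → E) (N : ℕ) (ω : Ω) : Fin N → E := fun i => X i ω

lemma measurable_sample {Ω E : Type*} [MeasurableSpace Ω] [MeasurableSpace E] {X : ℕ → Ω → E}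
    (hX : ∀ i, Measurable (X i)) (N : ℕ) : Measurable (sample X N) :=
  measurable_pi_lambda _ fun i => hX i

namespace IsIIDSample

variable {Ω : Type*} [MeasurableSpace Ω] {P : Measure Ω}

section MeasurableSpace

variable {E : Type*} [MeasurableSpace E] {X : ℕ → Ω → E} {μ : Measure E}

lemma isProbabilityMeasure (h : IsIIDSample X μ P) : IsProbabilityMeasure P :=
  h.indep.isProbabilityMeasure

lemma isProbabilityMeasure_law (h : IsIIDSample X μ P) : IsProbabilityMeasure μ := by
  have := h.isProbabilityMeasure
  exact h.map_eq 0 ▸ Measure.isProbabilityMeasure_map (h.measurable 0).aemeasurable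

lemma ae_comp (h : IsIIDSample X μ P) {p : E → Prop} (hp : ∀ᵐ x ∂μ, p x) (i : ℕ) :
    ∀ᵐ ω ∂P, p (X i ω) :=
  ae_of_ae_map (h.measurable i).aemeasurable ((h.map_eq i).symm ▸ hp)

lemma map_comp_eq_pi (h : IsIIDSample X μ P) {N : ℕ} {g : Fin N → ℕ}
    (hg : Function.Injective g) : P.map (fun ω i => X (g i) ω) = Measure.pi fun _ => μ := by
  have := h.isProbabilityMeasure
  rw [(iIndepFun_iff_map_fun_eq_pi_map fun i => (h.measurable (g i)).aemeasurable).1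
    (h.indep.precomp hg)]
  simp only [h.map_eq]

lemma identDistrib_sample_comp_perm (h : IsIIDSample X μ P) {N : ℕ} (σ : Equiv.Perm (Fin N)) :
    IdentDistrib (sample X N) (fun ω i => sample X N ω (σ i)) P P where
  aemeasurable_fst := (measurable_sample h.measurable N).aemeasurable
  aemeasurable_snd := (measurable_pi_lambda _ fun i => h.measurable (σ i)).aemeasurable
  map_eq := (h.map_comp_eq_pi Fin.val_injective).trans
    (h.map_comp_eq_pi (Fin.val_injective.comp σ.injective)).symm

end MeasurableSpace

variable {d : ℕ} {X : ℕ → Ω → EuclideanSpace ℝ (Fin d)}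
  {μ : Measure (EuclideanSpace ℝ (Fin d))}

lemma identDistrib_nnDist (h : IsIIDSample X μ P) {N : ℕ} (i j : Fin N) :
    IdentDistrib (fun ω => nnDist (sample X N ω) i) (fun ω => nnDist (sample X N ω) j) P P := by
  have hperm := (h.identDistrib_sample_comp_perm (Equiv.swap i j)).comp (measurable_nnDist i)
  simpa only [Function.comp_def, nnDist_comp_perm, Equiv.swap_apply_left] using hperm

lemma hasMinUniformLaw_nnBallProb (h : IsIIDSample X μ P)
    (hμ : ∀ x r, μ (Metric.sphere x r) = 0) (n : ℕ) :
    HasMinUniformLaw (fun ω => nnBallProb μ (sample X (n + 2) ω)) (n + 1) P := by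
  have := h.isProbabilityMeasure_law
  have hsample := measurable_sample h.measurable (n + 2)
  refine ⟨(measurable_nnBallProb μ).comp hsample,
    fun ω => ⟨measureReal_nonneg, measureReal_le_one⟩, fun s hs => ?_⟩
  rw [← pi_le_nnBallProb μ hμ hs, ← h.map_comp_eq_pi Fin.val_injective,
    Measure.map_apply hsample (measurableSet_le measurable_const (measurable_nnBallProb μ))]
  rfl

lemma ae_nnDist_pos (h : IsIIDSample X μ P) (hμ : ∀ x r, μ (Metric.sphere x r) = 0) (n : ℕ)
    (i : Fin (n + 2)) : ∀ᵐ ω ∂P, 0 < nnDist (sample X (n + 2) ω) i := by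
  have := h.isProbabilityMeasure
  refine (h.identDistrib_nnDist 0 i).ae_snd measurableSet_Ioi ?_
  filter_upwards [(h.hasMinUniformLaw_nnBallProb hμ n).ae_pos] with ω hω
  refine (nnDist_nonneg _ _).lt_of_ne fun hzero => hω.ne' ?_
  rw [nnBallProb, ← hzero, measureReal_def, Metric.closedBall_zero, ← Metric.sphere_zero, hμ,
    ENNReal.toReal_zero]

lemma ae_tendsto_nnDist (h : IsIIDSample X μ P) (hμ : ∀ x r, μ (Metric.sphere x r) = 0) :
    ∀ᵐ ω ∂P, Tendsto (fun n => nnDist (sample X (n + 2) ω) 0) atTop (𝓝[>] 0) := by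
  have := h.isProbabilityMeasure_law
  filter_upwards [HasMinUniformLaw.ae_exists_lt (h.hasMinUniformLaw_nnBallProb hμ),
    h.ae_comp Measure.support_mem_ae 0, ae_all_iff.2 fun n => h.ae_nnDist_pos hμ n 0]
    with ω hsmall hsupp hpos
  refine tendsto_nhdsWithin_iff.2 ⟨?_, Eventually.of_forall hpos⟩
  refine tendsto_order.2 ⟨fun r hr => Eventually.of_forall fun n => hr.trans (hpos n),
    fun r hr => ?_⟩
  obtain ⟨n, hn⟩ := hsmall _ (measureReal_closedBall_pos μ hsupp hr)
  filter_upwards [eventually_ge_atTop n] with m hm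
  refine (antitone_nnDist_zero (fun i => X i ω) hm).trans_lt (lt_of_not_ge fun hle => ?_)
  exact hn.not_ge (measureReal_mono (Metric.closedBall_subset_closedBall hle))

variable {f : EuclideanSpace ℝ (Fin d) → ℝ} {R₁ R₂ : ℝ}

lemma lintegral_comp_lt_top (h : IsIIDSample X (densityMeasure f) P) (hf : Measurable f)
    {u : EuclideanSpace ℝ (Fin d) → ℝ≥0∞} (hu : Measurable u)
    (hu_lt : ∫⁻ x, u x * ENNReal.ofReal (f x) < ∞) (i : ℕ) : ∫⁻ ω, u (X i ω) ∂P < ∞ := by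
  rwa [← lintegral_map hu (h.measurable i), h.map_eq, ← lintegral_mul_ofReal_density hf hu]

lemma lintegral_logBallMeanBound_lt_top (h : IsIIDSample X (densityMeasure f) P)
    (hf : Measurable f) (hM : HasLogMoments f R₁ R₂) :
    ∫⁻ ω, logBallMeanBound f R₁ R₂ (X 0 ω) (X 1 ω) ∂P < ∞ := by
  have := h.isProbabilityMeasure
  have := h.isProbabilityMeasure_law
  have hmax : Measurable fun x => ennPosLog (localMax f x R₁) :=
    measurable_ennPosLog.comp (measurable_localMax R₁)
  have hmin : Measurable fun x => ennPosLog (localMin f x R₂)⁻¹ :=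
    measurable_ennPosLog.comp (measurable_localMin R₂).inv
  have hnorm : Measurable fun x : EuclideanSpace ℝ (Fin d) => ENNReal.ofReal (Real.posLog ‖x‖) := by
    fun_prop
  have hmax₀ : Measurable fun ω => ennPosLog (localMax f (X 0 ω) R₁) := hmax.comp (h.measurable 0)
  have hmin₀ : Measurable fun ω => ennPosLog (localMin f (X 0 ω) R₂)⁻¹ :=
    hmin.comp (h.measurable 0)
  have hnorm₀ : Measurable fun ω => ENNReal.ofReal (Real.posLog ‖X 0 ω‖) :=
    hnorm.comp (h.measurable 0)
  refine (lintegral_mono fun ω => logBallMeanBound_le f R₁ R₂ (X 0 ω) (X 1 ω)).trans_lt ?_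
  rw [lintegral_add_right _ measurable_const, lintegral_const, measure_univ, mul_one,
    lintegral_add_left (hmax₀.fun_add hmin₀), lintegral_add_left hmax₀,
    lintegral_const_mul' _ _ (ENNReal.natCast_ne_top d), lintegral_add_left hnorm₀]
  have hmax_lt := h.lintegral_comp_lt_top hf hmax hM.localMax 0
  have hmin_lt := h.lintegral_comp_lt_top hf hmin hM.localMin 0
  have hnorm_lt := h.lintegral_comp_lt_top hf hnorm hM.norm
  have mul_lt_top : ∀ {a : ℝ≥0∞}, a < ∞ → d * a < ∞ := ENNReal.mul_lt_top (ENNReal.natCast_lt_top d)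
  simp only [ENNReal.add_lt_top, ENNReal.ofReal_lt_top, mul_lt_top, hmax_lt, hmin_lt, hnorm_lt,
    and_self]

lemma tendsto_integral_log_ballMean (h : IsIIDSample X (densityMeasure f) P) (hd : 1 ≤ d)
    (hf : Measurable f) (hR₁ : 0 < R₁) (hR₂ : 0 < R₂) (hM : HasLogMoments f R₁ R₂) :
    (∀ n : ℕ, Integrable
      (fun ω => Real.log (ballMean f (X 0 ω) (nnDist (sample X (n + 2) ω) 0)).toReal) P) ∧
    Integrable (fun ω => Real.log (f (X 0 ω))) P ∧
    Tendsto (fun n : ℕ =>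
        ∫ ω, Real.log (ballMean f (X 0 ω) (nnDist (sample X (n + 2) ω) 0)).toReal ∂P)
      atTop (𝓝 (∫ ω, Real.log (f (X 0 ω)) ∂P)) := by
  have := h.isProbabilityMeasure_law
  have hμ := densityMeasure_sphere hd f
  refine tendsto_integral_of_enorm_le
    (B := fun ω => logBallMeanBound f R₁ R₂ (X 0 ω) (X 1 ω)) (fun n => ?_) ?_
    (h.lintegral_logBallMeanBound_lt_top hf hM).ne ?_ ?_
  · exact (measurable_ballMean (h.measurable 0) ((measurable_nnDist 0).comp
      (measurable_sample h.measurable (n + 2)))).ennreal_toReal.log.aestronglyMeasurable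
  · exact ((measurable_logBallMeanBound R₁ R₂).comp
      ((h.measurable 0).prodMk (h.measurable 1))).aemeasurable
  · filter_upwards [h.ae_comp Measure.support_mem_ae 0,
      ae_all_iff.2 fun n => h.ae_nnDist_pos hμ n 0] with ω hsupp hpos n
    exact enorm_log_ballMean_le hsupp hR₁ hR₂ (hpos n)
      (nnDist_le (sample X (n + 2) ω) (i := 0) (j := 1) one_ne_zero)
  · filter_upwards [h.ae_comp (ae_tendsto_log_toReal_ballMean hd hf) 0, h.ae_tendsto_nnDist hμ]
      with ω hdiff hdist
    exact hdiff.comp hdist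

lemma integral_log_nnDist (h : IsIIDSample X (densityMeasure f) P) (hd : 1 ≤ d) {n : ℕ}
    (hI : Integrable
      (fun ω => Real.log (ballMean f (X 0 ω) (nnDist (sample X (n + 2) ω) 0)).toReal) P) :
    Integrable (fun ω => Real.log (nnDist (sample X (n + 2) ω) 0)) P ∧
    d * ∫ ω, Real.log (nnDist (sample X (n + 2) ω) 0) ∂P
      = -(harmonic (n + 1) : ℝ) - Real.log (unitBallVolume d)
        - ∫ ω, Real.log (ballMean f (X 0 ω) (nnDist (sample X (n + 2) ω) 0)).toReal ∂P := by
  have := h.isProbabilityMeasure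
  have := h.isProbabilityMeasure_law
  have hμ := densityMeasure_sphere hd f
  have hU := h.hasMinUniformLaw_nnBallProb hμ n
  have hdecomp : (fun ω => (d : ℝ) * Real.log (nnDist (sample X (n + 2) ω) 0)) =ᵐ[P]
      fun ω => Real.log (nnBallProb (densityMeasure f) (sample X (n + 2) ω))
        - Real.log (unitBallVolume d)
        - Real.log (ballMean f (X 0 ω) (nnDist (sample X (n + 2) ω) 0)).toReal := by
    filter_upwards [h.ae_comp Measure.support_mem_ae 0, h.ae_nnDist_pos hμ n 0] with ω hsupp hpos
    rw [log_toReal_ballMean hsupp hpos, nnBallProb, show sample X (n + 2) ω 0 = X 0 ω from rfl]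
    ring
  have hV := integrable_const (μ := P) (Real.log (unitBallVolume d))
  have hUV : Integrable (fun ω => Real.log (nnBallProb (densityMeasure f) (sample X (n + 2) ω))
      - Real.log (unitBallVolume d)) P := hU.integrable_log.sub hV
  constructor
  · refine (integrable_const_mul_iff (isUnit_iff_ne_zero.2 ?_) _).1
      ((hUV.sub hI).congr hdecomp.symm)
    positivity
  · rw [← integral_const_mul, integral_congr_ae hdecomp,
      integral_sub hUV hI, integral_sub hU.integrable_log hV, hU.integral_log, integral_const,
      probReal_univ, one_smul]

lemma integral_estimator (h : IsIIDSample X μ P) (hμ : ∀ x r, μ (Metric.sphere x r) = 0) {n : ℕ}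
    (hI : Integrable (fun ω => Real.log (nnDist (sample X (n + 2) ω) 0)) P) :
    Integrable (fun ω => estimator (sample X (n + 2) ω)) P ∧
    ∫ ω, estimator (sample X (n + 2) ω) ∂P
      = d * ∫ ω, Real.log (nnDist (sample X (n + 2) ω) 0) ∂P
        + (Real.log (unitBallVolume d) + Real.eulerMascheroniConstant + Real.log (n + 1)) := by
  have := h.isProbabilityMeasure
  have hident := fun i => (h.identDistrib_nnDist (N := n + 2) 0 i).comp Real.measurable_log
  have hint : ∀ i, Integrable (fun ω => Real.log (nnDist (sample X (n + 2) ω) i)) P :=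
    fun i => (hident i).integrable_snd hI
  have heq : ∀ i, ∫ ω, Real.log (nnDist (sample X (n + 2) ω) i) ∂P
      = ∫ ω, Real.log (nnDist (sample X (n + 2) ω) 0) ∂P := fun i => (hident i).integral_eq.symm
  have hdecomp : (fun ω => estimator (sample X (n + 2) ω)) =ᵐ[P] fun ω =>
      d * (1 / (n + 2 : ℕ) * ∑ i, Real.log (nnDist (sample X (n + 2) ω) i))
        + (Real.log (unitBallVolume d) + Real.eulerMascheroniConstant + Real.log (n + 1)) := by
    filter_upwards [ae_all_iff.2 fun i => h.ae_nnDist_pos hμ n i] with ω hpos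
    have hn : ((n + 2 : ℕ) : ℝ) - 1 = n + 1 := by push_cast; ring
    rw [estimator, log_nnGeomMean hpos, hn]
    ring
  have hsum : Integrable (fun ω => (d : ℝ) * (1 / (n + 2 : ℕ)
      * ∑ i, Real.log (nnDist (sample X (n + 2) ω) i))) P :=
    ((integrable_finsetSum _ fun i _ => hint i).const_mul _).const_mul _
  refine ⟨(hsum.add (integrable_const _)).congr hdecomp.symm, ?_⟩
  rw [integral_congr_ae hdecomp, integral_add hsum (integrable_const _), integral_const_mul,
    integral_const_mul, integral_finsetSum _ fun i _ => hint i]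
  have hn : ((n : ℝ) + 2) ≠ 0 := by positivity
  simp only [heq, Finset.sum_const, Finset.card_univ, Fintype.card_fin, nsmul_eq_mul,
    integral_const, probReal_univ, one_smul]
  push_cast
  field_simp

end IsIIDSample

end KozachenkoLeonenko

end

open KozachenkoLeonenko in
theorem theorem1_general {Ω : Type*} [MeasurableSpace Ω] {P : Measure Ω} {d : ℕ} (hd : 1 ≤ d)
    {f : EuclideanSpace ℝ (Fin d) → ℝ} (hf : Measurable f) (hf0 : ∀ x, 0 ≤ f x)
    {X : ℕ → Ω → EuclideanSpace ℝ (Fin d)} (hX : IsIIDSample X (densityMeasure f) P)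
    {R₁ R₂ : ℝ} (hR₁ : 0 < R₁) (hR₂ : 0 < R₂) (hM : HasLogMoments f R₁ R₂) :
    Integrable (fun x => f x * Real.log (f x)) ∧
    (∀ N ≥ 2, Integrable (fun ω => estimator (sample X N ω)) P) ∧
    Tendsto (fun N => ∫ ω, estimator (sample X N ω) ∂P) atTop (𝓝 (entropy f)) := by
  obtain ⟨hI, hlogf, hlim⟩ := hX.tendsto_integral_log_ballMean hd hf hR₁ hR₂ hM
  have hdist := fun n => hX.integral_log_nnDist hd (hI n)
  have hest := fun n => hX.integral_estimator (densityMeasure_sphere hd f) (hdist n).1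
  have hlaw : IdentDistrib (X 0) id P (densityMeasure f) :=
    ⟨(hX.measurable 0).aemeasurable, aemeasurable_id, (hX.map_eq 0).trans Measure.map_id.symm⟩
  have hlaw_log := hlaw.comp hf.log
  refine ⟨(integrable_densityMeasure_iff hf hf0).1 (hlaw_log.integrable_snd hlogf),
    fun N hN => ?_, ?_⟩
  · obtain ⟨n, rfl⟩ := Nat.exists_eq_add_of_le' hN
    exact (hest n).1
  · have hentropy : ∫ ω, Real.log (f (X 0 ω)) ∂P = -entropy f :=
      hlaw_log.integral_eq.trans (integral_log_densityMeasure hf hf0)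
    have hharmonic := Real.tendsto_harmonic_sub_log.comp (tendsto_add_atTop_nat 1)
    have hsub := (hharmonic.const_sub Real.eulerMascheroniConstant).sub hlim
    rw [hentropy, sub_self, zero_sub, neg_neg] at hsub
    refine (tendsto_add_atTop_iff_nat 2).1 (hsub.congr fun n => ?_)
    rw [(hest n).2, (hdist n).2, Function.comp_apply, Nat.cast_succ]
    ring

theorem theorem1 {Ω : Type*} [MeasurableSpace Ω] (P : Measure Ω) [IsProbabilityMeasure P]
    (d : ℕ) (hd : 1 ≤ d)
    (f : EuclideanSpace ℝ (Fin d) → ℝ) (hf_meas : Measurable f) (hf_nonneg : ∀ x, 0 ≤ f x)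
    (X : ℕ → Ω → EuclideanSpace ℝ (Fin d)) (hX_meas : ∀ i, Measurable (X i))
    (hX_indep : iIndepFun X P)
    (hX_law : ∀ i, P.map (X i) = volume.withDensity (fun x => ENNReal.ofReal (f x)))
    (ε₀ ε₁ ε₂ R₁ R₂ : ℝ) (hε₀ : 0 < ε₀) (hε₁ : 0 < ε₁) (hε₂ : 0 < ε₂)
    (hR₁ : 0 < R₁) (hR₂ : 0 < R₂)
    (hK : KozachenkoLeonenko.K f ε₀ < ∞)
    (hQ : KozachenkoLeonenko.Q f ε₁ R₁ < ∞)
    (hT : KozachenkoLeonenko.T f ε₂ R₂ < ∞) :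
    Integrable (fun x => f x * Real.log (f x)) volume ∧
    (∀ᶠ N : ℕ in atTop,
      Integrable (fun ω => KozachenkoLeonenko.estimator (fun i : Fin N => X i ω)) P) ∧
    Tendsto (fun N : ℕ => ∫ ω, KozachenkoLeonenko.estimator (fun i : Fin N => X i ω) ∂P)
      atTop (𝓝 (KozachenkoLeonenko.entropy f)) := by
  have hX : KozachenkoLeonenko.IsIIDSample X (KozachenkoLeonenko.densityMeasure f) P :=
    ⟨hX_meas, hX_indep, hX_law⟩
  have := hX.isProbabilityMeasure_law
  have hM := KozachenkoLeonenko.hasLogMoments_of_lt_top hf_meas hε₀ hε₁ hε₂ hK hQ hT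
  obtain ⟨hint, hest, hlim⟩ := theorem1_general hd hf_meas hf_nonneg hX hR₁ hR₂ hM
  exact ⟨hint, (eventually_ge_atTop 2).mono hest, hlim⟩
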